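/- For $a,b,z\in\mathbb R$ with $b\notin\{0,-1,-2,\dots\}$ let ${}_1F_1(a;b;z)=\sum_{n\ge 0}\frac{(a)_n z^n}{(b)_n n!}$, where $(a)_0=1$ and $(a)_n=a(a+1)\cdots(a+n-1)$. For $\alpha>0$ let $$D_\alpha(z)=\frac{2^{\alpha/2}}{\sqrt\pi}e^{-z^2/4}\Big(\cos\tfrac{\pi\alpha}{2}\,\Gamma\big(\tfrac{\alpha+1}{2}\big)\,{}_1F_1\big(-\tfrac{\alpha}{2};\tfrac12;\tfrac{z^2}{2}\big)+\sqrt2\,z\,\sin\tfrac{\pi\alpha}{2}\,\Gamma\big(\tfrac{\alpha}{2}+1\big)\,{}_1F_1\big(\tfrac12-\tfrac{\alpha}{2};\tfrac32;\tfrac{z^2}{2}\big)\Big)$$ be the parabolic cylinder function, and let $\mathcal H_\alpha(x,t)=t^{\alpha/2}e^{x^2/(4t)}D_\alpha\big(x/\sqrt t\big)$ for $x\in\mathbb R$, $t>0$, with the initial value $\mathcal H_\alpha(x,0)=x^\alpha$ (in particular $\mathcal H_\alpha(0,0)=0$). Theorem. Let $W=\{W_t\}_{t\ge 0}$ be a real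 standard Wiener process (so $W_0=0$ almost surely) and let $\alpha>0$. Then the process $\{\mathcal H_\alpha(W_t,t)\}_{t\ge 0}$ is a martingale with respect to the natural filtration of $W$; more generally, it is a martingale with respect to every filtration $(\mathcal F_t)_{t\ge 0}$ to which $W$ is adapted and such that $W_t-W_s$ is independent of $\mathcal F_s$ for all $0\le s\le t$. -/

import Mathlib

open MeasureTheory ProbabilityTheory
open scoped NNReal

/-- Kummer's confluent hypergeometric function
`₁F₁(a; b; z) = M(a, b, z) = ∑ₙ (a)ₙ zⁿ / ((b)ₙ n!)`, with `(a)ₙ = a (a + 1) ⋯ (a + n - 1)`.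
The series converges for every real `z` as soon as `b` is not a non-positive integer. -/
noncomputable def kummerM (a b z : ℝ) : ℝ :=
  ∑' n : ℕ, (ascPochhammer ℝ n).eval a * z ^ n / ((ascPochhammer ℝ n).eval b * (n.factorial : ℝ))

/-- The parabolic cylinder function `D_α(z) = U(-α - 1/2, z)`, expressed through confluent
hypergeometric functions. For `α > -1` (in particular `α > 0`) no Gamma factor is at a pole. -/
noncomputable def parabolicCylinderD (α z : ℝ) : ℝ :=
  1 / √Real.pi * (2 : ℝ) ^ (α / 2) * Real.exp (-(z ^ 2 / 4)) *
    (Real.cos (Real.pi * α / 2) * Real.Gamma ((α + 1) / 2) *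
        kummerM (-(α / 2)) (1 / 2) (z ^ 2 / 2) +
      √2 * z * Real.sin (Real.pi * α / 2) * Real.Gamma (α / 2 + 1) *
        kummerM (1 / 2 - α / 2) (3 / 2) (z ^ 2 / 2))

/-- The power-normalised parabolic cylinder function
`H_α(x, t) = t^(α/2) exp(x² / (4t)) D_α(x / √t)` for `t > 0`, extended to `t = 0` by its initial
value `H_α(x, 0) = x^α`. A Wiener process has `W 0 = 0` almost surely, so for `α > 0`
only the value `H_α(0, 0) = 0` matters at time zero. -/
noncomputable def powerParabolicCylinder (α x t : ℝ) : ℝ :=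
  if t = 0 then x ^ α
  else t ^ (α / 2) * Real.exp (x ^ 2 / (4 * t)) * parabolicCylinderD α (x / √t)

/-! ### Absolute moments of Gaussian laws -/

/-! For `t > 0` the exponential factors cancel and `H_α(x, t) = t^(α/2) E(x/√t)`, where `E(x) = ∑ dₖ
xᵏ/k!` with `dₖ₊₂ = (k - α) dₖ`, i.e. `E'' - xE' + αE = 0`. Only this recurrence matters, not `d₀`
and `d₁`. Since increments are independent of the past, the martingale property for `0 < s < t`
reduces, with `Z` standard Gaussian and `σ² = 1 - s/t`, to `𝔼 E(x + σZ) = (1 - σ²)^(α/2) E(x/√(1 -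
σ²))` (`integral_expSeries_affine`). Integrate termwise, expand `(x + σZ)ᵏ`, and collect the
coefficient of each `xʲ`: the Gaussian moments turn it into a binomial series with sum `dⱼ (1 -
σ²)^((α-j)/2)`. The rearrangement rests on `∑ |dₖ| 𝔼|Z|ᵏ/k! < ∞`: these terms are `O(k^(-1-α/2))`,
and `α > 0`. For `σ < 1` the law of `x + σZ` is dominated by a multiple of that of `Z`. For `s = 0`
one has `σ = 1`, and `𝔼 E(Z) = 0` comes from letting `σ → 1` in `d₀ (1 - σ²)^(α/2)`. -/

lemma integrable_pow_abs_gaussianReal (m : ℝ) (v : ℝ≥0) (k : ℕ) :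
    Integrable (fun x : ℝ => |x| ^ k) (gaussianReal m v) := by
  have h := (memLp_id_gaussianReal' (μ := m) (v := v) (k : ENNReal) (by simp)).integrable_norm_pow'
  simpa using h

lemma integrable_pow_gaussianReal (m : ℝ) (v : ℝ≥0) (k : ℕ) :
    Integrable (fun x : ℝ => x ^ k) (gaussianReal m v) := by
  refine (integrable_pow_abs_gaussianReal m v k).mono' (by fun_prop) (ae_of_all _ fun x => ?_)
  simp

lemma gaussianPDFReal_zero_one (x : ℝ) :
    gaussianPDFReal 0 1 x = (√(2 * Real.pi))⁻¹ * Real.exp (-(x ^ 2) / 2) := by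
  simp [gaussianPDFReal]

lemma integral_pow_abs_gaussianReal (k : ℕ) :
    ∫ x, |x| ^ k ∂(gaussianReal 0 1) =
      (√(2 * Real.pi))⁻¹ * (1 / 2 : ℝ) ^ (-((k : ℝ) + 1) / 2) * Real.Gamma (((k : ℝ) + 1) / 2) := by
  rw [integral_gaussianReal_eq_integral_smul one_ne_zero]
  have h1 : ∀ x : ℝ, gaussianPDFReal 0 1 x • |x| ^ k =
      (fun y : ℝ => (√(2 * Real.pi))⁻¹ * (y ^ (k : ℝ) * Real.exp (-(1 / 2) * y ^ (2 : ℝ)))) |x| := by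
    intro x
    simp only [gaussianPDFReal_zero_one, smul_eq_mul, Real.rpow_natCast, Real.rpow_ofNat, sq_abs]
    rw [show -(x ^ 2) / 2 = -(1 / 2) * x ^ 2 by ring]
    ring
  refine (integral_congr_ae (ae_of_all _ h1)).trans ((integral_comp_abs (f := fun y : ℝ =>
    (√(2 * Real.pi))⁻¹ * (y ^ (k : ℝ) * Real.exp (-(1 / 2) * y ^ (2 : ℝ))))).trans ?_)
  rw [integral_const_mul,
    integral_rpow_mul_exp_neg_mul_rpow (by norm_num) (by linarith [(Nat.cast_nonneg k : (0 : ℝ) ≤ k)])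
      (by norm_num)]
  ring

lemma integral_pow_abs_gaussianReal_add_two (k : ℕ) :
    ∫ x, |x| ^ (k + 2) ∂(gaussianReal 0 1) = ((k : ℝ) + 1) * ∫ x, |x| ^ k ∂(gaussianReal 0 1) := by
  have hk : (0 : ℝ) ≤ k := Nat.cast_nonneg k
  rw [integral_pow_abs_gaussianReal, integral_pow_abs_gaussianReal]
  push_cast
  rw [show ((k : ℝ) + 2 + 1) / 2 = ((k : ℝ) + 1) / 2 + 1 by ring,
    Real.Gamma_add_one (by positivity),
    show -((k : ℝ) + 2 + 1) / 2 = -((k : ℝ) + 1) / 2 + (-1) by ring,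
    Real.rpow_add (by norm_num), Real.rpow_neg_one]
  ring

lemma integral_pow_gaussianReal_of_odd {k : ℕ} (hk : Odd k) :
    ∫ x, x ^ k ∂(gaussianReal 0 1) = 0 := by
  have h : ∫ x, x ^ k ∂(gaussianReal 0 1) = ∫ x, (-x) ^ k ∂(gaussianReal 0 1) := by
    conv_lhs => rw [← neg_zero, ← gaussianReal_map_neg]
    rw [integral_map (by fun_prop) (by fun_prop)]
  simp_rw [hk.neg_pow, integral_neg] at h
  linarith

lemma integral_pow_two_mul_gaussianReal_div_factorial (m : ℕ) :
    (∫ x, x ^ (2 * m) ∂(gaussianReal 0 1)) / ((2 * m).factorial : ℝ) =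
      1 / (2 ^ m * (m.factorial : ℝ)) := by
  have habs : ∀ m : ℕ, ∫ x, x ^ (2 * m) ∂(gaussianReal 0 1) =
      ∫ x, |x| ^ (2 * m) ∂(gaussianReal 0 1) := fun m => by simp [pow_mul]
  induction m with
  | zero => simp
  | succ m ih =>
    rw [habs] at ih ⊢
    rw [show 2 * (m + 1) = 2 * m + 2 by ring, integral_pow_abs_gaussianReal_add_two,
      Nat.factorial_succ (2 * m + 1), Nat.factorial_succ (2 * m), Nat.factorial_succ m]
    have h1 : ((2 * m).factorial : ℝ) ≠ 0 := by positivity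
    have h2 : (m.factorial : ℝ) ≠ 0 := by positivity
    field_simp at ih ⊢
    push_cast
    rw [pow_succ]
    linear_combination (2 * (m : ℝ) + 1) * 2 * (m + 1) * ih

lemma integral_pow_gaussianReal_nonneg (k : ℕ) : 0 ≤ ∫ x, x ^ k ∂(gaussianReal 0 1) := by
  rcases Nat.even_or_odd k with hk | hk
  · exact integral_nonneg fun x => hk.pow_nonneg x
  · exact (integral_pow_gaussianReal_of_odd hk).ge

/-! ### Comparison of Gaussian densities -/

/-- Variance below 1 means lighter tails, so the density ratio is bounded whatever the mean. -/
lemma exists_gaussianPDFReal_le_mul (m : ℝ) {v : ℝ≥0} (hv0 : 0 < v) (hv1 : v < 1) :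
    ∃ C : ℝ, 0 ≤ C ∧ ∀ y, gaussianPDFReal m v y ≤ C * gaussianPDFReal 0 1 y := by
  have hv0' : (0 : ℝ) < v := hv0
  have hv1' : (v : ℝ) < 1 := hv1
  have hw : (0 : ℝ) < 1 - v := by linarith
  -- The exponent is the maximum of `y²/2 - (y - m)²/(2v)`, reached at `y = m/(1 - v)`; completing
  -- the square below shows it.
  refine ⟨(√(2 * Real.pi * v))⁻¹ * √(2 * Real.pi) * Real.exp (m ^ 2 / (2 * (1 - v))),
    by positivity, fun y => ?_⟩
  rw [gaussianPDFReal_zero_one, gaussianPDFReal]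
  have hpi : √(2 * Real.pi) ≠ 0 := by positivity
  rw [show (√(2 * Real.pi * v))⁻¹ * √(2 * Real.pi) * Real.exp (m ^ 2 / (2 * (1 - v))) *
      ((√(2 * Real.pi))⁻¹ * Real.exp (-(y ^ 2) / 2)) = (√(2 * Real.pi * v))⁻¹ *
      Real.exp (m ^ 2 / (2 * (1 - v)) + -(y ^ 2) / 2) by rw [Real.exp_add]; field_simp]
  gcongr
  rw [← sub_nonneg]
  have : m ^ 2 / (2 * (1 - v)) + -(y ^ 2) / 2 - -(y - m) ^ 2 / (2 * v) =
      (y * (1 - v) - m) ^ 2 / (2 * v * (1 - v)) := by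
    field_simp
    ring
  rw [this]
  positivity

lemma exists_integral_gaussianReal_le_mul (m : ℝ) {v : ℝ≥0} (hv0 : 0 < v) (hv1 : v < 1) :
    ∃ C : ℝ, 0 ≤ C ∧ ∀ k : ℕ, ∫ x, |x| ^ k ∂(gaussianReal m v) ≤
      C * ∫ x, |x| ^ k ∂(gaussianReal 0 1) := by
  obtain ⟨C, hC, h⟩ := exists_gaussianPDFReal_le_mul m hv0 hv1
  refine ⟨C, hC, fun k => ?_⟩
  have hint : ∀ (m : ℝ) {v : ℝ≥0}, v ≠ 0 →
      Integrable (fun x => gaussianPDFReal m v x * |x| ^ k) := by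
    intro m v hv
    have := integrable_pow_abs_gaussianReal m v k
    rw [gaussianReal_of_var_ne_zero _ hv,
      integrable_withDensity_iff_integrable_smul' (measurable_gaussianPDF m v)
        (ae_of_all _ fun _ => gaussianPDF_lt_top)] at this
    simpa [toReal_gaussianPDF] using this
  rw [integral_gaussianReal_eq_integral_smul hv0.ne',
    integral_gaussianReal_eq_integral_smul one_ne_zero, ← integral_const_mul]
  simp only [smul_eq_mul]
  refine integral_mono (hint m hv0.ne') ((hint 0 one_ne_zero).const_mul C) fun x => ?_
  have := mul_le_mul_of_nonneg_right (h x) (by positivity : 0 ≤ |x| ^ k)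
  simpa [mul_assoc] using this

lemma integral_affine_gaussianReal (f : ℝ → ℝ) (x σ : ℝ) (v : ℝ≥0) (hv : (v : ℝ) = σ ^ 2)
    (hf : Measurable f) :
    ∫ y, f (x + σ * y) ∂(gaussianReal 0 1) = ∫ y, f y ∂(gaussianReal x v) := by
  have h : gaussianReal x v = (gaussianReal 0 1).map (fun y => x + σ * y) := by
    rw [show (fun y : ℝ => x + σ * y) = (fun y => x + y) ∘ (fun y => σ * y) from rfl,
      ← Measure.map_map (by fun_prop) (by fun_prop), gaussianReal_map_const_mul,
      gaussianReal_map_const_add]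
    congr 1
    · simp
    · ext; simp [hv]
  rw [h, integral_map (by fun_prop) hf.aestronglyMeasurable]

/-! ### A summability criterion -/

/-- The hypothesis reads `a eₖ ≤ k eₖ - (k + 2) eₖ₊₂`, whose right side telescopes. -/
lemma summable_of_add_two_mul_le {e : ℕ → ℝ} {a : ℝ} (ha : 0 < a) (he : ∀ k, 0 ≤ e k) (K : ℕ)
    (h : ∀ k, K ≤ k → ((k : ℝ) + 2) * e (k + 2) ≤ ((k : ℝ) - a) * e k) : Summable e := by
  rw [← summable_nat_add_iff K]
  refine summable_of_sum_range_le (c := ((K : ℝ) * e K + (K + 1) * e (K + 1)) / a)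
    (fun n => he _) fun n => ?_
  rw [le_div_iff₀ ha]
  -- The telescoping has step two, so two boundary terms survive at each end.
  have key : (∑ i ∈ Finset.range n, e (i + K)) * a + ((n + K : ℕ) : ℝ) * e (n + K) +
      ((n + K : ℕ) + 1 : ℝ) * e (n + K + 1) ≤ (K : ℝ) * e K + (K + 1) * e (K + 1) := by
    induction n with
    | zero => simp
    | succ n ih =>
      rw [Finset.sum_range_succ, add_mul]
      have := h (n + K) (by omega)
      rw [show n + 1 + K = n + K + 1 by ring, show n + K + 1 + 1 = n + K + 2 by ring]
      push_cast at this ih ⊢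
      linarith
  have h1 : 0 ≤ ((n + K : ℕ) : ℝ) * e (n + K) := mul_nonneg (Nat.cast_nonneg _) (he _)
  have h2 : 0 ≤ ((n + K : ℕ) + 1 : ℝ) * e (n + K + 1) := mul_nonneg (by positivity) (he _)
  linarith

/-! ### Series solutions of the Hermite equation -/

/-- The exponential generating function `∑ₖ dₖ xᵏ / k!`. -/
noncomputable def expSeries (d : ℕ → ℝ) (x : ℝ) : ℝ :=
  ∑' k : ℕ, d k / (k.factorial : ℝ) * x ^ k

lemma measurable_expSeries (d : ℕ → ℝ) : Measurable (expSeries d) :=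
  Measurable.tsum fun k => by fun_prop

/-! ### Absolute convergence and termwise integration -/

section HermiteRecurrence

variable {d : ℕ → ℝ} {α : ℝ}

lemma abs_div_factorial_add_two (hd : ∀ k, d (k + 2) = ((k : ℝ) - α) * d k) {k : ℕ}
    (hk : α ≤ k) : ((k : ℝ) + 2) * (|d (k + 2)| / ((k + 2).factorial : ℝ)) * ((k : ℝ) + 1) =
      ((k : ℝ) - α) * (|d k| / (k.factorial : ℝ)) := by
  rw [hd, abs_mul, abs_of_nonneg (sub_nonneg.2 hk), Nat.factorial_succ (k + 1),
    Nat.factorial_succ k]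
  have : (k.factorial : ℝ) ≠ 0 := by positivity
  push_cast
  field_simp
  ring

/-- The factor `k + 1` gained by the moment cancels the one from the factorial, so the criterion
holds with equality and `a = α`. -/
lemma summable_abs_div_factorial_mul_moment (hα : 0 < α)
    (hd : ∀ k, d (k + 2) = ((k : ℝ) - α) * d k) :
    Summable fun k : ℕ => |d k| / (k.factorial : ℝ) * ∫ x, |x| ^ k ∂(gaussianReal 0 1) := by
  refine summable_of_add_two_mul_le hα
    (fun k => mul_nonneg (by positivity) (integral_nonneg fun x => by positivity)) ⌈α⌉₊
    fun k hk => ?_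
  have hk' : α ≤ k := (Nat.le_ceil α).trans (Nat.cast_le.2 hk)
  rw [integral_pow_abs_gaussianReal_add_two, ← mul_assoc ((k : ℝ) - α),
    ← abs_div_factorial_add_two hd hk']
  exact le_of_eq (by ring)

lemma summable_abs_div_factorial_mul_pow (hα : 0 < α)
    (hd : ∀ k, d (k + 2) = ((k : ℝ) - α) * d k) {r : ℝ} (hr : 0 ≤ r) :
    Summable fun k : ℕ => |d k| / (k.factorial : ℝ) * r ^ k := by
  -- The threshold ensures both `k - α ≥ 0` and `r² ≤ k + 1`.
  refine summable_of_add_two_mul_le hα (fun k => by positivity) (⌈α⌉₊ + ⌈r ^ 2⌉₊) fun k hk => ?_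
  have hk' : α ≤ k := (Nat.le_ceil α).trans (Nat.cast_le.2 (by omega))
  have hr' : r ^ 2 ≤ k + 1 := by
    have : r ^ 2 ≤ k := (Nat.le_ceil (r ^ 2)).trans (Nat.cast_le.2 (by omega))
    linarith
  rw [← mul_assoc ((k : ℝ) - α), ← abs_div_factorial_add_two hd hk', pow_add]
  have h0 : 0 ≤ ((k : ℝ) + 2) * (|d (k + 2)| / ((k + 2).factorial : ℝ)) * r ^ k := by positivity
  nlinarith [mul_le_mul_of_nonneg_left hr' h0]

lemma summable_expSeries (hα : 0 < α) (hd : ∀ k, d (k + 2) = ((k : ℝ) - α) * d k) (x : ℝ) :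
    Summable fun k : ℕ => d k / (k.factorial : ℝ) * x ^ k := by
  refine Summable.of_norm ?_
  simpa [abs_mul, abs_div] using summable_abs_div_factorial_mul_pow hα hd (abs_nonneg x)

lemma summable_abs_div_factorial_mul_affine_moment (hα : 0 < α)
    (hd : ∀ k, d (k + 2) = ((k : ℝ) - α) * d k) (x : ℝ) {σ : ℝ} (hσ0 : 0 < σ) (hσ1 : σ < 1) :
    Summable fun k : ℕ =>
      |d k| / (k.factorial : ℝ) * ∫ y, |x + σ * y| ^ k ∂(gaussianReal 0 1) := by
  have hv0 : 0 < (NNReal.mk (σ ^ 2) (sq_nonneg σ) : ℝ≥0) := by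
    rw [← NNReal.coe_pos]; exact pow_pos hσ0 2
  have hv1 : (NNReal.mk (σ ^ 2) (sq_nonneg σ) : ℝ≥0) < 1 := by
    rw [← NNReal.coe_lt_coe]; exact pow_lt_one₀ hσ0.le hσ1 two_ne_zero
  obtain ⟨C, hC, h⟩ := exists_integral_gaussianReal_le_mul x hv0 hv1
  refine Summable.of_nonneg_of_le
    (fun k => mul_nonneg (by positivity) (integral_nonneg fun x => by positivity)) (fun k => ?_)
    ((summable_abs_div_factorial_mul_moment hα hd).mul_left C)
  rw [integral_affine_gaussianReal (fun z => |z| ^ k) x σ (NNReal.mk (σ ^ 2) (sq_nonneg σ)) rfl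
    (by fun_prop), mul_left_comm]
  exact mul_le_mul_of_nonneg_left (h k) (by positivity)

lemma integrable_affine_pow (x σ : ℝ) (k : ℕ) :
    Integrable (fun y => (x + σ * y) ^ k) (gaussianReal 0 1) := by
  have h : MemLp (fun y : ℝ => x + σ * y) k (gaussianReal 0 1) :=
    (memLp_const x).add ((memLp_id_gaussianReal' (k : ENNReal) (by simp)).const_mul σ)
  refine (h.integrable_norm_pow').mono' (by fun_prop) (ae_of_all _ fun y => ?_)
  simp

lemma hasSum_integral_expSeries {μ : Measure ℝ} {g : ℝ → ℝ}
    (hg : ∀ k : ℕ, Integrable (fun y => g y ^ k) μ)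
    (hs : Summable fun k : ℕ => |d k| / (k.factorial : ℝ) * ∫ y, |g y| ^ k ∂μ) :
    HasSum (fun k : ℕ => d k / (k.factorial : ℝ) * ∫ y, g y ^ k ∂μ)
      (∫ y, expSeries d (g y) ∂μ) := by
  have := hasSum_integral_of_summable_integral_norm
    (F := fun (k : ℕ) y => d k / (k.factorial : ℝ) * g y ^ k) (μ := μ)
    (fun k => (hg k).const_mul _) (by
      simpa [abs_mul, abs_div, integral_const_mul] using hs)
  simpa [integral_const_mul, expSeries] using this

lemma integrable_expSeries (hα : 0 < α) (hd : ∀ k, d (k + 2) = ((k : ℝ) - α) * d k) :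
    Integrable (expSeries d) (gaussianReal 0 1) := by
  have hs := summable_abs_div_factorial_mul_moment hα hd
  refine ⟨(measurable_expSeries d).aestronglyMeasurable, ?_⟩
  have hF : ∀ k : ℕ, Integrable (fun y : ℝ => d k / (k.factorial : ℝ) * y ^ k)
      (gaussianReal 0 1) := fun k => (integrable_pow_gaussianReal 0 1 k).const_mul _
  calc ∫⁻ y, ‖expSeries d y‖ₑ ∂(gaussianReal 0 1)
      ≤ ∫⁻ y, ∑' k : ℕ, ‖d k / (k.factorial : ℝ) * y ^ k‖ₑ ∂(gaussianReal 0 1) :=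
        lintegral_mono fun y => enorm_tsum_le_tsum_enorm
    _ = ∑' k : ℕ, ∫⁻ y, ‖d k / (k.factorial : ℝ) * y ^ k‖ₑ ∂(gaussianReal 0 1) :=
        lintegral_tsum fun k => by fun_prop
    _ = ∑' k : ℕ, ENNReal.ofReal
          (|d k| / (k.factorial : ℝ) * ∫ x, |x| ^ k ∂(gaussianReal 0 1)) := by
        refine tsum_congr fun k => ?_
        rw [← ofReal_integral_norm_eq_lintegral_enorm (hF k), ← integral_const_mul]
        simp
    _ < ⊤ := hs.tsum_ofReal_lt_top

/-- Binomial expansion of the moments of an affine image of the standard Gaussian law. -/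
lemma integral_affine_pow_div_factorial (x σ : ℝ) (k : ℕ) :
    (∫ y, (x + σ * y) ^ k ∂(gaussianReal 0 1)) / (k.factorial : ℝ) =
      ∑ p ∈ Finset.HasAntidiagonal.antidiagonal k,
        x ^ p.1 / (p.1.factorial : ℝ) *
        (σ ^ p.2 * ((∫ y, y ^ p.2 ∂(gaussianReal 0 1)) / (p.2.factorial : ℝ))) := by
  simp_rw [(Commute.all x _).add_pow', nsmul_eq_mul]
  rw [integral_finsetSum, Finset.sum_div]
  · refine Finset.sum_congr rfl fun p hp => ?_
    obtain rfl := Finset.HasAntidiagonal.mem_antidiagonal.1 hp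
    simp_rw [mul_pow, integral_const_mul]
    rw [Nat.cast_add_choose]
    have : ((p.1 + p.2).factorial : ℝ) ≠ 0 := by positivity
    field_simp
  · intro p hp
    simp_rw [mul_pow]
    exact ((((integrable_pow_gaussianReal 0 1 p.2).const_mul _).const_mul _).const_mul _)

end HermiteRecurrence

/-! ### Binomial series and Gaussian averaging -/

lemma hasSum_ascPochhammer_mul_pow (b : ℝ) {q : ℝ} (hq : |q| < 1) :
    HasSum (fun m : ℕ => (ascPochhammer ℝ m).eval b / (m.factorial : ℝ) * q ^ m)
      ((1 - q) ^ (-b)) := by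
  have h := (Real.one_div_one_sub_rpow_hasFPowerSeriesOnBall_zero b).hasSum (y := q) (by
    rw [Metric.mem_eball, edist_zero_right, ← ofReal_norm, Real.norm_eq_abs]
    exact ENNReal.ofReal_lt_one.2 hq)
  have hq' : 0 ≤ 1 - q := by linarith [le_abs_self q]
  rw [zero_add, one_div, ← Real.rpow_neg hq'] at h
  refine Eq.subst (motive := fun f => HasSum f _) (funext fun m => ?_) h
  symm
  rw [FormalMultilinearSeries.ofScalars_apply_eq, smul_eq_mul, ← Ring.multichoose_eq]
  congr 1
  rw [← Polynomial.ascPochhammer_smeval_eq_eval,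
    ← Ring.factorial_nsmul_multichoose_eq_ascPochhammer, nsmul_eq_mul]
  field_simp

section HermiteRecurrence

variable {d : ℕ → ℝ} {α : ℝ}

lemma coeff_add_two_mul (hd : ∀ k, d (k + 2) = ((k : ℝ) - α) * d k) (j m : ℕ) :
    d (j + 2 * m) = d j * 2 ^ m * (ascPochhammer ℝ m).eval (((j : ℝ) - α) / 2) := by
  induction m with
  | zero => simp
  | succ m ih =>
    rw [show j + 2 * (m + 1) = j + 2 * m + 2 by ring, hd, ih, ascPochhammer_succ_eval]
    push_cast
    ring

lemma hasSum_coeff_mul_moment_of_even (f : ℕ → ℝ) (σ : ℝ) {s : ℝ}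
    (h : HasSum (fun m : ℕ => f (2 * m) * (σ ^ (2 * m) * (1 / (2 ^ m * (m.factorial : ℝ))))) s) :
    HasSum (fun l : ℕ =>
      f l * (σ ^ l * ((∫ y, y ^ l ∂(gaussianReal 0 1)) / (l.factorial : ℝ)))) s := by
  rw [← Function.Injective.hasSum_iff (mul_right_injective₀ (two_ne_zero (α := ℕ)))]
  · simpa only [Function.comp_def, integral_pow_two_mul_gaussianReal_div_factorial] using h
  · intro l hl
    have : Odd l := by
      rw [← Nat.not_even_iff_odd]
      rintro ⟨m, rfl⟩
      exact hl ⟨m, (two_mul m)⟩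
    simp [integral_pow_gaussianReal_of_odd this]

/-- Only even `l = 2m` contribute; the `2ᵐ` in `d (j + 2m)` cancels that of the moment, leaving the
binomial series at `q = σ²` with parameter `(j - α)/2`. -/
lemma hasSum_coeff_add_mul_moment (hd : ∀ k, d (k + 2) = ((k : ℝ) - α) * d k) (j : ℕ) {σ : ℝ}
    (hσ0 : 0 < σ) (hσ1 : σ < 1) :
    HasSum (fun l : ℕ =>
      d (j + l) * (σ ^ l * ((∫ y, y ^ l ∂(gaussianReal 0 1)) / (l.factorial : ℝ))))
      (d j * (1 - σ ^ 2) ^ ((α - j) / 2)) := by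
  refine hasSum_coeff_mul_moment_of_even (fun l => d (j + l)) σ ?_
  have hq : |σ ^ 2| < 1 := by
    rw [abs_of_pos (pow_pos hσ0 2)]; exact pow_lt_one₀ hσ0.le hσ1 two_ne_zero
  have h := (hasSum_ascPochhammer_mul_pow (((j : ℝ) - α) / 2) hq).mul_left (d j)
  rw [show -(((j : ℝ) - α) / 2) = (α - j) / 2 by ring] at h
  refine Eq.subst (motive := fun f => HasSum f _) (funext fun m => ?_) h
  symm
  rw [coeff_add_two_mul hd, pow_mul]
  field_simp

/-- Gaussian moments are nonnegative, so taking norms only replaces `x` by `|x|` and `dₖ` by `|dₖ|`: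
the `k`-th antidiagonal then sums to `|dₖ|/k!` times the `k`-th moment of `|x| + σZ`. -/
lemma summable_antidiagonal_expansion (hα : 0 < α)
    (hd : ∀ k, d (k + 2) = ((k : ℝ) - α) * d k) (x : ℝ) {σ : ℝ} (hσ0 : 0 < σ) (hσ1 : σ < 1) :
    Summable fun p : ℕ × ℕ => x ^ p.1 / (p.1.factorial : ℝ) * (d (p.1 + p.2) *
      (σ ^ p.2 * ((∫ y, y ^ p.2 ∂(gaussianReal 0 1)) / (p.2.factorial : ℝ)))) := by
  refine Summable.of_norm ?_
  rw [← Finset.HasAntidiagonal.sigmaAntidiagonalEquivProd.summable_iff]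
  refine (summable_sigma_of_nonneg (fun _ => norm_nonneg _)).2 ?_
  refine ⟨fun k => (hasSum_fintype _).summable, ?_⟩
  refine Summable.of_nonneg_of_le (fun k => tsum_nonneg fun _ => norm_nonneg _) (fun k => ?_)
    (summable_abs_div_factorial_mul_affine_moment hα hd |x| hσ0 hσ1)
  rw [tsum_fintype]
  have h1 : ∀ p : Finset.HasAntidiagonal.antidiagonal k,
      ‖x ^ p.1.1 / (p.1.1.factorial : ℝ) * (d (p.1.1 + p.1.2) *
        (σ ^ p.1.2 * ((∫ y, y ^ p.1.2 ∂(gaussianReal 0 1)) / (p.1.2.factorial : ℝ))))‖ =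
      |d k| * (|x| ^ p.1.1 / (p.1.1.factorial : ℝ) *
        (σ ^ p.1.2 * ((∫ y, y ^ p.1.2 ∂(gaussianReal 0 1)) / (p.1.2.factorial : ℝ)))) := by
    rintro ⟨p, hp⟩
    rw [Finset.HasAntidiagonal.mem_antidiagonal] at hp
    simp only [hp, norm_mul, norm_div, norm_pow, Real.norm_eq_abs, abs_of_pos hσ0, Nat.abs_cast,
      abs_of_nonneg (integral_pow_gaussianReal_nonneg p.2)]
    ring
  refine (Finset.sum_congr rfl fun p _ => h1 p).trans_le ?_
  rw [← Finset.mul_sum, Finset.univ_eq_attach,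
    Finset.sum_attach _ (fun p : ℕ × ℕ => |x| ^ p.1 / (p.1.factorial : ℝ) *
        (σ ^ p.2 * ((∫ y, y ^ p.2 ∂(gaussianReal 0 1)) / (p.2.factorial : ℝ)))),
    ← integral_affine_pow_div_factorial, mul_div_assoc', mul_comm (|d k| / _), mul_div_assoc',
    mul_comm]
  have hle : ∫ y, (|x| + σ * y) ^ k ∂(gaussianReal 0 1) ≤
      ∫ y, |(|x| + σ * y)| ^ k ∂(gaussianReal 0 1) := by
    refine (le_abs_self _).trans ((abs_integral_le_integral_abs).trans_eq ?_)
    simp_rw [abs_pow]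
  gcongr ?_ / _
  exact mul_le_mul_of_nonneg_right hle (abs_nonneg _)

/-- Gaussian averaging of a series solution of the Hermite equation rescales it. -/
lemma integral_expSeries_affine (hα : 0 < α) (hd : ∀ k, d (k + 2) = ((k : ℝ) - α) * d k)
    (x : ℝ) {σ : ℝ} (hσ0 : 0 < σ) (hσ1 : σ < 1) :
    ∫ y, expSeries d (x + σ * y) ∂(gaussianReal 0 1) =
      (1 - σ ^ 2) ^ (α / 2) * expSeries d (x / √(1 - σ ^ 2)) := by
  have hv : 0 < 1 - σ ^ 2 := by nlinarith
  have hF := (summable_antidiagonal_expansion hα hd x hσ0 hσ1).hasSum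
  -- The same double series is summed by rows, giving the rescaled series, and by antidiagonals,
  -- giving the integral.
  have hrow := hF.prod_fiberwise fun j =>
    (hasSum_coeff_add_mul_moment hd j hσ0 hσ1).mul_left (x ^ j / (j.factorial : ℝ))
  have hdiag := (Finset.HasAntidiagonal.sigmaAntidiagonalEquivProd.hasSum_iff.2 hF).sigma
    fun k => hasSum_fintype _
  have hint := hasSum_integral_expSeries (d := d) (integrable_affine_pow x σ)
    (summable_abs_div_factorial_mul_affine_moment hα hd x hσ0 hσ1)
  have h1 : ∫ y, expSeries d (x + σ * y) ∂(gaussianReal 0 1) =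
      ∑' p : ℕ × ℕ, x ^ p.1 / (p.1.factorial : ℝ) * (d (p.1 + p.2) *
      (σ ^ p.2 * ((∫ y, y ^ p.2 ∂(gaussianReal 0 1)) / (p.2.factorial : ℝ)))) := by
    refine hint.unique ?_
    convert hdiag using 2 with k
    rw [div_mul_eq_mul_div, mul_div_assoc, integral_affine_pow_div_factorial, Finset.mul_sum,
      ← Finset.sum_attach, ← Finset.univ_eq_attach]
    refine Finset.sum_congr rfl fun p _ => ?_
    have hp : p.1.1 + p.1.2 = k := Finset.HasAntidiagonal.mem_antidiagonal.1 p.2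
    simp only [Function.comp_apply, Finset.HasAntidiagonal.sigmaAntidiagonalEquivProd_apply, hp]
    ring
  rw [h1, ← hrow.tsum_eq, expSeries, ← tsum_mul_left]
  refine tsum_congr fun j => ?_
  have h2 : (1 - σ ^ 2) ^ ((α - j) / 2) = (1 - σ ^ 2) ^ (α / 2) / √(1 - σ ^ 2) ^ j := by
    rw [Real.sqrt_eq_rpow, ← Real.rpow_natCast (_ ^ (1 / 2 : ℝ)), ← Real.rpow_mul hv.le, ← Real.rpow_sub hv]
    congr 1
    ring
  rw [h2, div_pow]
  ring

lemma summable_coeff_two_mul (hα : 0 < α) (hd : ∀ k, d (k + 2) = ((k : ℝ) - α) * d k) :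
    Summable fun m : ℕ => |d (2 * m)| * (1 / (2 ^ m * (m.factorial : ℝ))) := by
  have h := (summable_abs_div_factorial_mul_moment hα hd).comp_injective
    (mul_right_injective₀ (two_ne_zero (α := ℕ)))
  refine h.congr fun m => ?_
  rw [← integral_pow_two_mul_gaussianReal_div_factorial]
  simp only [Function.comp_apply, pow_mul, sq_abs]
  ring

/-- The Gaussian mean is zero. -/
lemma integral_expSeries_eq_zero (hα : 0 < α) (hd : ∀ k, d (k + 2) = ((k : ℝ) - α) * d k) :
    ∫ y, expSeries d y ∂(gaussianReal 0 1) = 0 := by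
  have hsum := summable_coeff_two_mul hα hd
  have hsum' : Summable fun m : ℕ => d (2 * m) * ((1 : ℝ) ^ (2 * m) *
      (1 / (2 ^ m * (m.factorial : ℝ)))) := by
    refine Summable.of_norm (hsum.congr fun m => ?_)
    simp
  have hint : HasSum _ (∫ y, expSeries d y ∂(gaussianReal 0 1)) :=
    hasSum_integral_expSeries (d := d) (g := fun y => y)
      (integrable_pow_gaussianReal 0 1) (summable_abs_div_factorial_mul_moment hα hd)
  have hone := hasSum_coeff_mul_moment_of_even d 1 hsum'.hasSum
  have hval : ∫ y, expSeries d y ∂(gaussianReal 0 1) =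
      ∑' m : ℕ, d (2 * m) * ((1 : ℝ) ^ (2 * m) * (1 / (2 ^ m * (m.factorial : ℝ)))) := by
    refine hint.unique ?_
    convert hone using 2 with k
    rw [one_pow]
    ring
  -- Abel-type limit: the row sum for `j = 0` is known only for `σ < 1`, and dominated convergence
  -- carries it to `σ = 1`.
  have hlim : Filter.Tendsto (fun σ : ℝ => ∑' m : ℕ, d (2 * m) * (σ ^ (2 * m) *
      (1 / (2 ^ m * (m.factorial : ℝ))))) (nhdsWithin 1 (Set.Ioo 0 1))
      (nhds (∑' m : ℕ, d (2 * m) * ((1 : ℝ) ^ (2 * m) *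
        (1 / (2 ^ m * (m.factorial : ℝ)))))) := by
    refine tendsto_tsum_of_dominated_convergence hsum (fun m => ?_) ?_
    · exact (Continuous.tendsto (by fun_prop) 1).mono_left nhdsWithin_le_nhds
    · filter_upwards [self_mem_nhdsWithin] with σ hσ m
      rw [norm_mul, Real.norm_eq_abs]
      refine mul_le_mul_of_nonneg_left ?_ (abs_nonneg _)
      rw [norm_mul, norm_pow, Real.norm_of_nonneg hσ.1.le, Real.norm_of_nonneg (by positivity)]
      exact mul_le_of_le_one_left (by positivity) (pow_le_one₀ hσ.1.le hσ.2.le)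
  have hzero : Filter.Tendsto (fun σ : ℝ => d 0 * (1 - σ ^ 2) ^ (α / 2))
      (nhdsWithin 1 (Set.Ioo 0 1)) (nhds 0) := by
    have hc : Continuous fun σ : ℝ => d 0 * (1 - σ ^ 2) ^ (α / 2) :=
      continuous_const.mul ((by fun_prop : Continuous fun σ : ℝ => 1 - σ ^ 2).rpow_const
        fun _ => Or.inr (by positivity))
    have := (hc.tendsto 1).mono_left (nhdsWithin_le_nhds (s := Set.Ioo 0 1))
    simpa [Real.zero_rpow (by positivity : α / 2 ≠ 0)] using this
  have : (nhdsWithin (1 : ℝ) (Set.Ioo 0 1)).NeBot := by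
    rw [nhdsWithin_Ioo_eq_nhdsLT one_pos]; infer_instance
  rw [hval]
  refine tendsto_nhds_unique hlim (hzero.congr' ?_)
  filter_upwards [self_mem_nhdsWithin] with σ hσ
  have hs : Summable fun m : ℕ => d (2 * m) * (σ ^ (2 * m) *
      (1 / (2 ^ m * (m.factorial : ℝ)))) := by
    refine Summable.of_norm_bounded hsum fun m => ?_
    rw [norm_mul, Real.norm_eq_abs]
    refine mul_le_mul_of_nonneg_left ?_ (abs_nonneg _)
    rw [norm_mul, norm_pow, Real.norm_of_nonneg hσ.1.le, Real.norm_of_nonneg (by positivity)]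
    exact mul_le_of_le_one_left (by positivity) (pow_le_one₀ hσ.1.le hσ.2.le)
  have h0 := hasSum_coeff_add_mul_moment hd 0 hσ.1 hσ.2
  simp only [zero_add, Nat.cast_zero, sub_zero] at h0
  exact h0.unique (hasSum_coeff_mul_moment_of_even d σ hs.hasSum)

end HermiteRecurrence

/-! ### The parabolic cylinder function as a series -/

/-- The coefficients `d₀ = A`, `d₁ = B`, `dₖ₊₂ = (k - α) dₖ`. -/
def hermiteCoeff (α A B : ℝ) : ℕ → ℝ
  | 0 => A
  | 1 => B
  | k + 2 => ((k : ℝ) - α) * hermiteCoeff α A B k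

lemma hermiteCoeff_add_two (α A B : ℝ) (k : ℕ) :
    hermiteCoeff α A B (k + 2) = ((k : ℝ) - α) * hermiteCoeff α A B k := rfl

lemma ascPochhammer_eval_half_mul (n : ℕ) :
    (ascPochhammer ℝ n).eval (1 / 2) * (n.factorial : ℝ) * 4 ^ n = ((2 * n).factorial : ℝ) := by
  induction n with
  | zero => simp
  | succ n ih =>
    rw [show 2 * (n + 1) = 2 * n + 1 + 1 by ring, Nat.factorial_succ (2 * n + 1),
      Nat.factorial_succ (2 * n), Nat.factorial_succ n, ascPochhammer_succ_eval]
    push_cast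
    rw [← ih]
    ring

lemma ascPochhammer_eval_three_halves_mul (n : ℕ) :
    (ascPochhammer ℝ n).eval (3 / 2) * (n.factorial : ℝ) * 4 ^ n =
      ((2 * n + 1).factorial : ℝ) := by
  induction n with
  | zero => simp
  | succ n ih =>
    rw [show 2 * (n + 1) + 1 = 2 * n + 1 + 1 + 1 by ring, Nat.factorial_succ (2 * n + 1 + 1),
      Nat.factorial_succ (2 * n + 1), Nat.factorial_succ n, ascPochhammer_succ_eval]
    push_cast
    rw [← ih]
    ring

lemma expSeries_even_term {d : ℕ → ℝ} {α : ℝ}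
    (hd : ∀ k, d (k + 2) = ((k : ℝ) - α) * d k) (z : ℝ) (n : ℕ) :
    d (2 * n) / ((2 * n).factorial : ℝ) * z ^ (2 * n) =
      d 0 * ((ascPochhammer ℝ n).eval (-(α / 2)) * (z ^ 2 / 2) ^ n /
        ((ascPochhammer ℝ n).eval (1 / 2) * (n.factorial : ℝ))) := by
  have h := coeff_add_two_mul hd 0 n
  rw [zero_add, Nat.cast_zero, show (0 - α) / 2 = -(α / 2) by ring] at h
  have hf : ((2 * n).factorial : ℝ) ≠ 0 := by positivity
  rw [← ascPochhammer_eval_half_mul] at hf ⊢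
  have h1 := left_ne_zero_of_mul (left_ne_zero_of_mul hf)
  rw [h, show (4 : ℝ) ^ n = 2 ^ n * 2 ^ n by rw [← mul_pow]; norm_num, pow_mul, div_pow]
  generalize (ascPochhammer ℝ n).eval (1 / 2 : ℝ) = b at h1 ⊢
  field_simp

lemma expSeries_odd_term {d : ℕ → ℝ} {α : ℝ}
    (hd : ∀ k, d (k + 2) = ((k : ℝ) - α) * d k) (z : ℝ) (n : ℕ) :
    d (2 * n + 1) / ((2 * n + 1).factorial : ℝ) * z ^ (2 * n + 1) =
      d 1 * (z * ((ascPochhammer ℝ n).eval (1 / 2 - α / 2) * (z ^ 2 / 2) ^ n /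
        ((ascPochhammer ℝ n).eval (3 / 2) * (n.factorial : ℝ)))) := by
  have h := coeff_add_two_mul hd 1 n
  rw [add_comm, Nat.cast_one, show (1 - α) / 2 = 1 / 2 - α / 2 by ring] at h
  have hf : ((2 * n + 1).factorial : ℝ) ≠ 0 := by positivity
  rw [← ascPochhammer_eval_three_halves_mul] at hf ⊢
  have h1 := left_ne_zero_of_mul (left_ne_zero_of_mul hf)
  rw [h, show (4 : ℝ) ^ n = 2 ^ n * 2 ^ n by rw [← mul_pow]; norm_num, pow_succ, pow_mul, div_pow]
  generalize (ascPochhammer ℝ n).eval (3 / 2 : ℝ) = b at h1 ⊢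
  field_simp

/-- Even and odd indices each form a Kummer series in `z²/2`. -/
lemma expSeries_eq_kummerM {d : ℕ → ℝ} {α : ℝ} (hα : 0 < α)
    (hd : ∀ k, d (k + 2) = ((k : ℝ) - α) * d k) (z : ℝ) :
    expSeries d z = d 0 * kummerM (-(α / 2)) (1 / 2) (z ^ 2 / 2) +
      d 1 * (z * kummerM (1 / 2 - α / 2) (3 / 2) (z ^ 2 / 2)) := by
  have hs := summable_expSeries hα hd z
  have he := hs.comp_injective (i := fun n : ℕ => 2 * n) fun a b h => by simpa using h
  have ho := hs.comp_injective (i := fun n : ℕ => 2 * n + 1) fun a b h => by simpa using h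
  have h := tsum_even_add_odd (f := fun k : ℕ => d k / (k.factorial : ℝ) * z ^ k) he ho
  simp only [expSeries_even_term hd z, expSeries_odd_term hd z, tsum_mul_left] at h
  exact h.symm

lemma exists_powerParabolicCylinder_eq {α : ℝ} (hα : 0 < α) :
    ∃ d : ℕ → ℝ, (∀ k, d (k + 2) = ((k : ℝ) - α) * d k) ∧ ∀ x t : ℝ, 0 < t →
      powerParabolicCylinder α x t = t ^ (α / 2) * expSeries d (x / √t) := by
  refine ⟨hermiteCoeff α
    (1 / √Real.pi * (2 : ℝ) ^ (α / 2) * (Real.cos (Real.pi * α / 2) * Real.Gamma ((α + 1) / 2)))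
    (1 / √Real.pi * (2 : ℝ) ^ (α / 2) *
      (√2 * Real.sin (Real.pi * α / 2) * Real.Gamma (α / 2 + 1))),
    hermiteCoeff_add_two _ _ _, fun x t ht => ?_⟩
  rw [expSeries_eq_kummerM hα (hermiteCoeff_add_two _ _ _), powerParabolicCylinder, if_neg ht.ne', parabolicCylinderD,
    hermiteCoeff, hermiteCoeff]
  have hexp : Real.exp (x ^ 2 / (4 * t)) * Real.exp (-((x / √t) ^ 2 / 4)) = 1 := by
    rw [← Real.exp_add, div_pow, Real.sq_sqrt ht.le, Real.exp_eq_one_iff]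
    field_simp
    ring
  linear_combination (t ^ (α / 2) * (1 / √Real.pi * (2 : ℝ) ^ (α / 2)) *
    (Real.cos (Real.pi * α / 2) * Real.Gamma ((α + 1) / 2) *
        kummerM (-(α / 2)) (1 / 2) ((x / √t) ^ 2 / 2) +
      √2 * (x / √t) * Real.sin (Real.pi * α / 2) * Real.Gamma (α / 2 + 1) *
        kummerM (1 / 2 - α / 2) (3 / 2) ((x / √t) ^ 2 / 2))) * hexp

lemma measurable_powerParabolicCylinder {α : ℝ} (hα : 0 < α) (t : ℝ≥0) :
    Measurable fun x => powerParabolicCylinder α x t := by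
  obtain ⟨d, -, h⟩ := exists_powerParabolicCylinder_eq hα
  rcases eq_or_lt_of_le (zero_le (a := t)) with rfl | ht
  · simp only [powerParabolicCylinder, NNReal.coe_zero, if_true]
    fun_prop
  · simp_rw [fun x => h x t ht]
    exact ((measurable_expSeries d).comp (measurable_id.div_const _)).const_mul _

/-! ### Gaussian averages -/

lemma gaussianReal_zero_eq_map (t : ℝ≥0) :
    gaussianReal 0 t = (gaussianReal 0 1).map (fun y => √(t : ℝ) * y) := by
  rw [gaussianReal_map_const_mul]
  congr 1
  · simp
  · ext; simp

lemma integrable_powerParabolicCylinder {α : ℝ} (hα : 0 < α) (t : ℝ≥0) :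
    Integrable (fun x => powerParabolicCylinder α x t) (gaussianReal 0 t) := by
  rcases eq_or_lt_of_le (zero_le (a := t)) with rfl | ht
  · rw [gaussianReal_zero_var]
    exact integrable_dirac (by simp)
  obtain ⟨d, hd, h⟩ := exists_powerParabolicCylinder_eq hα
  rw [gaussianReal_zero_eq_map, integrable_map_measure
    (measurable_powerParabolicCylinder hα t).aestronglyMeasurable (by fun_prop)]
  have hsq : √(t : ℝ) ≠ 0 := (Real.sqrt_pos.2 ht).ne'
  refine ((integrable_expSeries hα hd).const_mul ((t : ℝ) ^ (α / 2))).congr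
    (ae_of_all _ fun y => ?_)
  simp only [Function.comp_apply, h _ _ (NNReal.coe_pos.2 ht), mul_div_cancel_left₀ y hsq]

lemma integral_powerParabolicCylinder {α : ℝ} (hα : 0 < α) {t : ℝ≥0} (ht : 0 < t) :
    ∫ y, powerParabolicCylinder α y t ∂(gaussianReal 0 t) = 0 := by
  obtain ⟨d, hd, h⟩ := exists_powerParabolicCylinder_eq hα
  have hsq : √(t : ℝ) ≠ 0 := (Real.sqrt_pos.2 ht).ne'
  rw [gaussianReal_zero_eq_map, integral_map (by fun_prop)
    (measurable_powerParabolicCylinder hα t).aestronglyMeasurable]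
  simp_rw [h _ _ (NNReal.coe_pos.2 ht), mul_div_cancel_left₀ _ hsq, integral_const_mul,
    integral_expSeries_eq_zero hα hd, mul_zero]

/-- Averaging identity at `x/√t` with `σ² = (t - s)/t`, so `1 - σ² = s/t`; `s > 0` gives `σ < 1`. -/
lemma integral_powerParabolicCylinder_add {α : ℝ} (hα : 0 < α) {s t : ℝ≥0} (hs : 0 < s)
    (hst : s < t) (x : ℝ) :
    ∫ y, powerParabolicCylinder α (x + y) t ∂(gaussianReal 0 (t - s)) =
      powerParabolicCylinder α x s := by
  obtain ⟨d, hd, h⟩ := exists_powerParabolicCylinder_eq hα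
  have hs' : (0 : ℝ) < s := hs
  have hst' : (s : ℝ) < t := hst
  have ht' : (0 : ℝ) < t := hs'.trans hst'
  have hσ : ((t : ℝ) - s) / t = 1 - s / t := by field_simp
  have hσ2 : √(((t : ℝ) - s) / t) ^ 2 = 1 - s / t := by
    rw [Real.sq_sqrt (div_nonneg (by linarith) ht'.le), hσ]
  have hσ0 : 0 < √(((t : ℝ) - s) / t) := Real.sqrt_pos.2 (div_pos (by linarith) ht')
  have hσ1 : √(((t : ℝ) - s) / t) < 1 := by
    rw [hσ, Real.sqrt_lt' one_pos]
    have : 0 < (s : ℝ) / t := by positivity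
    linarith
  rw [gaussianReal_zero_eq_map, integral_map (by fun_prop)
    (f := fun y => powerParabolicCylinder α (x + y) t)
    ((measurable_powerParabolicCylinder hα t).comp (measurable_const_add x)).aestronglyMeasurable]
  simp_rw [h _ _ ht', h _ _ hs', integral_const_mul, NNReal.coe_sub hst.le]
  have h1 : ∀ y : ℝ, (x + √((t : ℝ) - s) * y) / √(t : ℝ) =
      x / √(t : ℝ) + √(((t : ℝ) - s) / t) * y := fun y => by
    rw [Real.sqrt_div (by linarith)]; ring
  simp_rw [h1]
  rw [integral_expSeries_affine hα hd _ hσ0 hσ1, hσ2, sub_sub_cancel, ← mul_assoc,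
    ← Real.mul_rpow ht'.le (by positivity), mul_div_cancel₀ _ ht'.ne', Real.sqrt_div hs'.le,
    div_div_div_cancel_right₀ (Real.sqrt_pos.2 ht').ne']

/-! ### Conditional expectation of a function of two independent variables -/

/-- By independence the joint law is a product, so the conditional law of `Y` given `U` is constant.
-/
lemma condExp_prodMk_of_indepFun {Ω β : Type*} {mΩ : MeasurableSpace Ω} {mβ : MeasurableSpace β}
    {P : Measure Ω} [IsFiniteMeasure P] {U : Ω → β} {Y : Ω → ℝ} (hU : Measurable U)
    (hY : Measurable Y) (hind : IndepFun U Y P) {F : β × ℝ → ℝ} (hF : Measurable F)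
    (hint : Integrable (fun ω => F (U ω, Y ω)) P) :
    P[fun ω => F (U ω, Y ω) | mβ.comap U] =ᵐ[P] fun ω => ∫ y, F (U ω, y) ∂(P.map Y) := by
  refine (condExp_prod_ae_eq_integral_condDistrib hU hY.aemeasurable hF.stronglyMeasurable hint).trans ?_
  have h : condDistrib Y U P =ᵐ[P.map U] Kernel.const β (P.map Y) := by
    refine condDistrib_ae_eq_of_measure_eq_compProd U hY.aemeasurable ?_
    rw [Measure.compProd_const,
      (indepFun_iff_map_prod_eq_prod_map_map hU.aemeasurable hY.aemeasurable).1 hind]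
  filter_upwards [ae_of_ae_map hU.aemeasurable h] with ω hω
  rw [hω, Kernel.const_apply]

lemma condExp_comp_add_of_indep {Ω : Type*} {m mΩ : MeasurableSpace Ω} {P : Measure Ω}
    [IsFiniteMeasure P] (hm : m ≤ mΩ) {X Y : Ω → ℝ} (hX : Measurable[m] X)
    (hY : Measurable Y) (hind : Indep (MeasurableSpace.comap Y inferInstance) m P) {f : ℝ → ℝ}
    (hf : Measurable f) (hint : Integrable (fun ω => f (X ω + Y ω)) P) :
    P[fun ω => f (X ω + Y ω) | m] =ᵐ[P] fun ω => ∫ y, f (X ω + y) ∂(P.map Y) := by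
  have hF : @Measurable (Ω × ℝ) ℝ (@Prod.instMeasurableSpace Ω ℝ m _) _
      (fun p : Ω × ℝ => f (X p.1 + p.2)) :=
    hf.comp ((hX.comp (@measurable_fst Ω ℝ m _)).add (@measurable_snd Ω ℝ m _))
  -- Take `U` to be the identity from `(Ω, mΩ)` to `(Ω, m)`: it generates exactly `m`.
  have hind' : @IndepFun Ω Ω ℝ mΩ m _ id Y P := by
    refine (@IndepFun_iff_Indep Ω Ω ℝ mΩ m _ id Y P).2 ?_
    rw [MeasurableSpace.comap_id]
    exact hind.symm
  have h := condExp_prodMk_of_indepFun (mβ := m) (F := fun p : Ω × ℝ => f (X p.1 + p.2))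
    (measurable_id'' hm) hY hind' hF hint
  rwa [MeasurableSpace.comap_id] at h

/-! ### The martingale property -/

lemma martingale_powerParabolicCylinder {Ω : Type*} {mΩ : MeasurableSpace Ω} {P : Measure Ω}
    [IsProbabilityMeasure P] {W : ℝ≥0 → Ω → ℝ} (hW : IsPreBrownianReal W P)
    (hmeas : ∀ t, Measurable (W t)) {α : ℝ} (hα : 0 < α) {ℱ : Filtration ℝ≥0 mΩ}
    (hadapt : StronglyAdapted ℱ W)
    (hind : ∀ s t : ℝ≥0, s ≤ t →
      Indep (MeasurableSpace.comap (fun ω => W t ω - W s ω) (inferInstance : MeasurableSpace ℝ))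
        (ℱ s) P) :
    Martingale (fun (t : ℝ≥0) (ω : Ω) => powerParabolicCylinder α (W t ω) (t : ℝ)) ℱ P := by
  have hadapt' : StronglyAdapted ℱ
      (fun (t : ℝ≥0) (ω : Ω) => powerParabolicCylinder α (W t ω) (t : ℝ)) := fun t =>
    ((measurable_powerParabolicCylinder hα t).comp (hadapt t).measurable).stronglyMeasurable
  have hint : ∀ t : ℝ≥0, Integrable (fun ω => powerParabolicCylinder α (W t ω) (t : ℝ)) P := by
    intro t
    have h := integrable_powerParabolicCylinder hα t
    rw [← (hW.hasLaw_eval t).map_eq, integrable_map_measure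
      (measurable_powerParabolicCylinder hα t).aestronglyMeasurable
      (hmeas t).aemeasurable] at h
    exact h
  refine ⟨hadapt', fun s t hst => ?_⟩
  rcases hst.eq_or_lt with rfl | hlt
  · exact (condExp_of_stronglyMeasurable (ℱ.le s) (hadapt' s) (hint s)).eventuallyEq
  have hlaw : P.map (fun ω => W t ω - W s ω) = gaussianReal 0 (t - s) := by
    have h := (hW.hasLaw_sub t s).map_eq
    have hd : nndist t.1 s.1 = t - s := by
      ext
      rw [coe_nndist, Real.dist_eq, NNReal.coe_sub hst]
      exact abs_of_nonneg (sub_nonneg.2 hst)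
    rw [hd] at h
    exact h
  have hcond := condExp_comp_add_of_indep (ℱ.le s) (hadapt s).measurable
    (Y := fun ω => W t ω - W s ω) ((hmeas t).sub (hmeas s)) (hind s t hst)
    (measurable_powerParabolicCylinder hα t)
    ((hint t).congr (ae_of_all _ fun ω => by simp))
  have hcond' : P[fun ω => powerParabolicCylinder α (W t ω) t | ℱ s] =ᵐ[P]
      fun ω => ∫ y, powerParabolicCylinder α (W s ω + y) t ∂(gaussianReal 0 (t - s)) := by
    rw [← hlaw]
    simpa using hcond
  refine hcond'.trans ?_
  -- At `s = 0` both sides vanish almost surely: `W 0 = 0`, `0 ^ α = 0`, and the mean at time `t` is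
  -- zero.
  rcases eq_or_ne s 0 with rfl | hs
  · filter_upwards [hW.eval_zero_ae_eq_zero] with ω hω
    simp only [hω, zero_add, tsub_zero]
    rw [integral_powerParabolicCylinder hα hlt]
    simp [powerParabolicCylinder, Real.zero_rpow hα.ne']
  · exact ae_of_all _ fun ω =>
      integral_powerParabolicCylinder_add hα (pos_iff_ne_zero.2 hs) hlt (W s ω)

/-- The increment is the coordinate at `t - s` of the process restarted at `s`, which is independent
of the past. -/
lemma indep_increment_natural {Ω : Type*} {mΩ : MeasurableSpace Ω} {P : Measure Ω}
    {W : ℝ≥0 → Ω → ℝ} (hW : IsPreBrownianReal W P)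
    (hmeas : ∀ t, StronglyMeasurable (W t)) {s t : ℝ≥0} (hst : s ≤ t) :
    Indep (MeasurableSpace.comap (fun ω => W t ω - W s ω) (inferInstance : MeasurableSpace ℝ))
      (Filtration.natural W hmeas s) P := by
  have hφ : Measurable fun x : ℝ≥0 → ℝ => x (t - s) := measurable_pi_apply (t - s)
  have h := (hW.indepFun_shift s).comp hφ measurable_id
  rw [IndepFun_iff_Indep] at h
  rw [Filtration.natural_eq_comap]
  simpa [Function.comp_def, add_tsub_cancel_of_le hst] using h

theorem mainTheorem2 {Ω : Type*} {mΩ : MeasurableSpace Ω} (P : Measure Ω) [IsProbabilityMeasure P]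
    (W : ℝ≥0 → Ω → ℝ) (hW : IsBrownianReal W P) (hmeas : ∀ t, StronglyMeasurable (W t))
    (α : ℝ) (hα : 0 < α) :
    -- martingale with respect to the natural filtration of `W`
    Martingale (fun (t : ℝ≥0) (ω : Ω) => powerParabolicCylinder α (W t ω) (t : ℝ))
        (Filtration.natural W hmeas) P ∧
      -- and with respect to every filtration for which `W` is a Wiener process
      ∀ ℱ : Filtration ℝ≥0 mΩ,
        StronglyAdapted ℱ W →
        (∀ s t : ℝ≥0, s ≤ t →
          Indep (MeasurableSpace.comap (fun ω => W t ω - W s ω) (inferInstance : MeasurableSpace ℝ))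
            (ℱ s) P) →
        Martingale (fun (t : ℝ≥0) (ω : Ω) => powerParabolicCylinder α (W t ω) (t : ℝ)) ℱ P := by
  have hm : ∀ t, Measurable (W t) := fun t => (hmeas t).measurable
  exact ⟨martingale_powerParabolicCylinder hW.toIsPreBrownianReal hm hα
      (Filtration.stronglyAdapted_natural hmeas)
      fun s t hst => indep_increment_natural hW.toIsPreBrownianReal hmeas hst,
    fun ℱ hadapt hind =>
      martingale_powerParabolicCylinder hW.toIsPreBrownianReal hm hα hadapt hind⟩
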